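/- An \emph{alternating sign matrix} is a square matrix with entries in $\{0,1,-1\}$ in which every row and every column sums to $1$ and the nonzero entries of every row and of every column alternate in sign. The \emph{X-ray} of an $n\times n$ matrix $A$ is the vector $(x_1,\dots,x_{2n-1})$ of its antidiagonal sums $x_k=\sum_{i+j=k+1}A_{i,j}$. An $n\times n$ alternating sign matrix is \emph{determined by its X-ray} if no other $n\times n$ alternating sign matrix has the same X-ray. Draw a Dyck path of semilength $n$ in the $n\times n$ grid of matrix cells, from the top left to the bottom right corner, with unit east and south steps, never going below the main diagonal. A peak is a grid point of the path that is entered by an east step and left by a south step; a valley is a grid point of the path that is entered by a south step and left by an east step. Let $\mathcal A$ be the map that sends the path to the $n\times n$ matrix with entry $1$ in each cell lying, on the antidiagonal, between a peak and its mirror image in the main diagonal, entry $-1$ in each cell lying, on the antidiagonal, between a valley and its mirror image, and entry $0$ in every other cell. (A valley on the main diagonal coincides with its mirror image and contributes no cell.) \textbf{Theorem.} For every $n\ge 0$, the map $\mathcal A$ is a bijection from the set of Dyck paths of semilength $n$ onto the set of $n\times n$ alternating sign matrices that are determined by their X-rays. -/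

import Mathlib

/-- An `n × n` alternating sign matrix: the entries are `0`, `1` or `-1`, every row and every
column sums to `1`, and consecutive nonzero entries of a row or of a column have opposite signs. -/
structure IsASM {n : ℕ} (A : Matrix (Fin n) (Fin n) ℤ) : Prop where
  entries : ∀ i j, A i j = 0 ∨ A i j = 1 ∨ A i j = -1
  row_sum : ∀ i, ∑ j, A i j = 1
  col_sum : ∀ j, ∑ i, A i j = 1
  row_alternates : ∀ i j j', j < j' → A i j ≠ 0 → A i j' ≠ 0 →
    (∀ l, j < l → l < j' → A i l = 0) → A i j' = -A i j
  col_alternates : ∀ j i i', i < i' → A i j ≠ 0 → A i' j ≠ 0 →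
    (∀ l, i < l → l < i' → A l j = 0) → A i' j = -A i j

/-- The vector of the `2 * n - 1` antidiagonal sums. Rows, columns and antidiagonals are counted
from `0`, so that the antidiagonal `k` consists of the cells with `i + j = k`. -/
def xray {n : ℕ} (A : Matrix (Fin n) (Fin n) ℤ) (k : Fin (2 * n - 1)) : ℤ :=
  ∑ i : Fin n, ∑ j : Fin n, if (i : ℕ) + (j : ℕ) = (k : ℕ) then A i j else 0

/-- `A` is an alternating sign matrix, and no other alternating sign matrix has its X-ray. -/
def IsDeterminedByXRay {n : ℕ} (A : Matrix (Fin n) (Fin n) ℤ) : Prop :=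
  IsASM A ∧ ∀ B : Matrix (Fin n) (Fin n) ℤ, IsASM B → xray B = xray A → B = A

/-! A Dyck path is a `DyckWord`, whose letters `U` and `D` are read as east and south steps
respectively. It is drawn in the grid of an `n × n` matrix, starting at the top left corner. -/

namespace DyckPath

/-- The number of rows that lie above the grid point reached after `k` steps. -/
def south (p : DyckWord) (k : ℕ) : ℕ := (p.toList.take k).count DyckStep.D

/-- The number of columns that lie to the left of the grid point reached after `k` steps. -/
def east (p : DyckWord) (k : ℕ) : ℕ := (p.toList.take k).count DyckStep.U

/-- The numbers `k` such that the grid point reached after `k + 1` steps is a peak: it is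
entered by an east step and left by a south step. -/
def peaks (p : DyckWord) : Finset ℕ :=
  {k ∈ Finset.range p.toList.length |
    p.toList[k]? = some DyckStep.U ∧ p.toList[k + 1]? = some DyckStep.D}

/-- The numbers `k` such that the grid point reached after `k + 1` steps is a valley: it is
entered by a south step and left by an east step. -/
def valleys (p : DyckWord) : Finset ℕ :=
  {k ∈ Finset.range p.toList.length |
    p.toList[k]? = some DyckStep.D ∧ p.toList[k + 1]? = some DyckStep.U}

/-- The cell in row `i` and column `j` (counted from `0`) is crossed, from its north-east corner
`(i, j + 1)` to its south-west corner `(i + 1, j)`, by the antidiagonal segment that joins the grid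
point `(a, b)` (`a` rows down, `b` columns to the right, `a ≤ b`) to its mirror image `(b, a)`.
For `a = b` there is no such cell. -/
def CellBetween (a b i j : ℕ) : Prop := i + (j + 1) = a + b ∧ a ≤ i ∧ i + 1 ≤ b

instance (a b i j : ℕ) : Decidable (CellBetween a b i j) :=
  inferInstanceAs (Decidable (_ ∧ _))

/-- The matrix of a Dyck path: `1` in the cells between a peak and its mirror image, `-1` in the
cells between a valley and its mirror image, and `0` in all other cells. -/
def toMatrix (n : ℕ) (p : DyckWord) : Matrix (Fin n) (Fin n) ℤ := fun i j =>
  if ∃ k ∈ peaks p, CellBetween (south p (k + 1)) (east p (k + 1)) i j then 1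
  else if ∃ k ∈ valleys p, CellBetween (south p (k + 1)) (east p (k + 1)) i j then -1
  else 0

end DyckPath

/-! Alternating sign matrices correspond to their corner sums `C`, and the X-ray is the second
difference of the antidiagonal sums of `C`. So two matrices share an X-ray exactly when their corner
sums have equal sums over every antidiagonal (`IsCornerSum.xray_eq_iff`). The matrix of a Dyck path
has corner sums `min (min i j) (s (i + j))`, where `s k` counts the south steps among the first `k`.

Such a `C` is unique (`DyckPath.cornerSum_unique`): once one antidiagonal is known, an east step
makes the next one pointwise least possible, a south step pointwise greatest possible, and then
equality of the sums forces equality of the entries.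

Conversely, pushing every level set `C ≥ t` of every antidiagonal to the top right yields corner
sums with the same antidiagonal sums. A unique `C` is thus already pushed, and it is symmetric
because its transpose also competes. Each nonempty level set then fills its whole admissible
interval, which gives the above form of `C` (`IsCornerSum.eq_min_of_unique`); the values at the
middles of the antidiagonals trace the Dyck path. -/

open Finset.HasAntidiagonal (antidiagonal)

/-! ### Corner sums and their second differences -/

/-- The functions `C` on `ℕ × ℕ` which are the corner sums of an `n × n` alternating sign matrix,
extended by zero. -/
structure IsCornerSum (n : ℕ) (C : ℕ → ℕ → ℕ) : Prop where
  zero_left : ∀ j, C 0 j = 0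
  zero_right : ∀ i, C i 0 = 0
  le_left : ∀ i j, C i j ≤ C (i + 1) j
  left_le : ∀ i j, C (i + 1) j ≤ C i j + 1
  le_right : ∀ i j, C i j ≤ C i (j + 1)
  right_le : ∀ i j, C i (j + 1) ≤ C i j + 1
  left_full : ∀ i j, n ≤ i → C i j = min j n
  right_full : ∀ i j, n ≤ j → C i j = min i n

namespace IsCornerSum

variable {n : ℕ} {C : ℕ → ℕ → ℕ}

theorem transpose (h : IsCornerSum n C) : IsCornerSum n (fun i j => C j i) :=
  ⟨h.zero_right, h.zero_left, fun i j => h.le_right j i, fun i j => h.right_le j i,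
    fun i j => h.le_left j i, fun i j => h.left_le j i, fun i j => h.right_full j i,
    fun i j => h.left_full j i⟩

theorem le_fst (h : IsCornerSum n C) (i j : ℕ) : C i j ≤ i := by
  induction i with
  | zero => exact (h.zero_left j).le
  | succ i ih => exact (h.left_le i j).trans (by omega)

theorem le_snd (h : IsCornerSum n C) (i j : ℕ) : C i j ≤ j := h.transpose.le_fst j i

theorem le_size (h : IsCornerSum n C) (i j : ℕ) : C i j ≤ n := by
  have := monotone_nat_of_le_succ (f := fun i => C i j) (fun i => h.le_left i j)
    (Nat.le_add_right i n)
  have := h.left_full (i + n) j (by omega)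
  simp only at *
  omega

/-- From column `j` to column `n`, where the value is `i`, `C` grows by at most `n - j`. -/
theorem add_le (h : IsCornerSum n C) (i j : ℕ) (hi : i ≤ n) (hj : j ≤ n) : i + j ≤ C i j + n := by
  have key : ∀ d, C i (j + d) ≤ C i j + d := by
    intro d
    induction d with
    | zero => simp
    | succ d ih => exact (h.right_le i (j + d)).trans (by omega)
  have h1 := key (n - j)
  rw [show j + (n - j) = n by omega, h.right_full i n le_rfl] at h1
  omega

end IsCornerSum

/-- The second difference of `C`, restricted to an `n × n` matrix. -/
def diffMatrix (n : ℕ) (C : ℕ → ℕ → ℕ) : Matrix (Fin n) (Fin n) ℤ := fun i j =>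
  (C (i + 1) (j + 1) : ℤ) - C i (j + 1) - C (i + 1) j + C i j

/-- The sum of `C` over the antidiagonal `i + j = m`. -/
def antidiagonalSum (C : ℕ → ℕ → ℕ) (m : ℕ) : ℕ := ∑ p ∈ antidiagonal m, C p.1 p.2

theorem antidiagonalSum_transpose (C : ℕ → ℕ → ℕ) :
    antidiagonalSum (fun i j => C j i) = antidiagonalSum C := by
  funext m
  exact Finset.Nat.sum_antidiagonal_swap (f := fun p => C p.1 p.2)

theorem diffMatrix_injective {n : ℕ} {C C' : ℕ → ℕ → ℕ} (h : IsCornerSum n C)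
    (h' : IsCornerSum n C') (e : diffMatrix n C = diffMatrix n C') : C = C' := by
  have key : ∀ i j, C i j = C' i j := by
    intro i
    induction i with
    | zero => intro j; rw [h.zero_left, h'.zero_left]
    | succ i ihi =>
      intro j
      induction j with
      | zero => rw [h.zero_right, h'.zero_right]
      | succ j ihj =>
        by_cases hi : i < n
        · by_cases hj : j < n
          · have := congrFun (congrFun e ⟨i, hi⟩) ⟨j, hj⟩
            simp only [diffMatrix] at this
            have := ihi j
            have := ihi (j + 1)
            omega
          · rw [h.right_full _ _ (by omega), h'.right_full _ _ (by omega)]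
        · rw [h.left_full _ _ (by omega), h'.left_full _ _ (by omega)]
  funext i j
  exact key i j

/-! ### From corner sums to alternating sign matrices -/

/-- A `0`-`1` sequence changes its value alternately up and down. -/
theorem sub_eq_neg_sub_of_zero_between {r : ℕ → ℤ} (hr : ∀ j, r j = 0 ∨ r j = 1) {j j' : ℕ}
    (hjj : j < j') (h0 : r (j + 1) - r j ≠ 0) (h1 : r (j' + 1) - r j' ≠ 0)
    (hz : ∀ l, j < l → l < j' → r (l + 1) - r l = 0) :
    r (j' + 1) - r j' = -(r (j + 1) - r j) := by
  have key : ∀ d, j + 1 + d ≤ j' → r (j + 1 + d) = r (j + 1) := by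
    intro d
    induction d with
    | zero => simp
    | succ d ih =>
      intro hd
      have := hz (j + 1 + d) (by omega) (by omega)
      rw [← ih (by omega)]
      exact sub_eq_zero.mp this
  have h2 := key (j' - (j + 1)) (by omega)
  rw [show j + 1 + (j' - (j + 1)) = j' by omega] at h2
  have := hr j
  have := hr (j + 1)
  have := hr j'
  have := hr (j' + 1)
  omega

theorem diffMatrix_transpose (n : ℕ) (C : ℕ → ℕ → ℕ) (i j : Fin n) :
    diffMatrix n (fun i j => C j i) i j = diffMatrix n C j i := by
  simp only [diffMatrix]
  ring

namespace IsCornerSum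

variable {n : ℕ} {C : ℕ → ℕ → ℕ}

theorem row_step (h : IsCornerSum n C) (i j : ℕ) :
    (C (i + 1) j : ℤ) - C i j = 0 ∨ (C (i + 1) j : ℤ) - C i j = 1 := by
  have := h.le_left i j
  have := h.left_le i j
  omega

theorem sum_row_diffMatrix (h : IsCornerSum n C) (i : Fin n) : ∑ j, diffMatrix n C i j = 1 := by
  have := Finset.sum_range_sub (fun j => (C (i + 1) j : ℤ) - C i j) n
  rw [h.zero_right, h.zero_right, h.right_full _ _ le_rfl, h.right_full _ _ le_rfl] at this
  rw [Finset.sum_range] at this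
  have hi := i.isLt
  calc ∑ j, diffMatrix n C i j
      = ∑ j : Fin n, ((C (i + 1) (j + 1) : ℤ) - C i (j + 1) - (C (i + 1) j - C i j)) :=
        Finset.sum_congr rfl fun j _ => by simp only [diffMatrix]; ring
    _ = 1 := by rw [this]; omega

theorem diffMatrix_row_alternates (h : IsCornerSum n C) (i j j' : Fin n) (hj : j < j')
    (h0 : diffMatrix n C i j ≠ 0) (h1 : diffMatrix n C i j' ≠ 0)
    (hz : ∀ l, j < l → l < j' → diffMatrix n C i l = 0) :
    diffMatrix n C i j' = -diffMatrix n C i j := by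
  have e : ∀ l : Fin n, diffMatrix n C i l =
      ((C (i + 1) (l + 1) : ℤ) - C i (l + 1)) - (C (i + 1) l - C i l) := by
    intro l
    simp only [diffMatrix]
    ring
  rw [e] at h0 h1
  rw [e, e]
  refine sub_eq_neg_sub_of_zero_between (r := fun j => (C (i + 1) j : ℤ) - C i j)
    (fun j => h.row_step i j) (Fin.lt_def.mp hj) h0 h1 ?_
  intro l hl hl'
  have := hz ⟨l, hl'.trans j'.isLt⟩ hl hl'
  rwa [e] at this

theorem isASM_diffMatrix (h : IsCornerSum n C) : IsASM (diffMatrix n C) where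
  entries i j := by
    have := h.row_step i j
    have := h.row_step i (j + 1)
    simp only [diffMatrix]
    omega
  row_sum := h.sum_row_diffMatrix
  col_sum j := by
    have := h.transpose.sum_row_diffMatrix j
    simpa only [diffMatrix_transpose] using this
  row_alternates := h.diffMatrix_row_alternates
  col_alternates j i i' hi h0 h1 hz := by
    have := h.transpose.diffMatrix_row_alternates j i i' hi
    simp only [diffMatrix_transpose] at this
    exact this h0 h1 hz

/-! ### X-rays and antidiagonal sums -/

/-- Each shifted copy of `C` runs over a later antidiagonal, apart from end cells where `C`
vanishes. -/
theorem sum_antidiagonal_diff (h : IsCornerSum n C) (k : ℕ) :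
    ∑ p ∈ antidiagonal k,
      ((C (p.1 + 1) (p.2 + 1) : ℤ) - C p.1 (p.2 + 1) - C (p.1 + 1) p.2 + C p.1 p.2) =
    antidiagonalSum C (k + 2) - 2 * antidiagonalSum C (k + 1) + antidiagonalSum C k := by
  have e1 : antidiagonalSum C (k + 1) = ∑ p ∈ antidiagonal k, C (p.1 + 1) p.2 := by
    rw [antidiagonalSum, Finset.Nat.sum_antidiagonal_succ, h.zero_left, zero_add]
  have e2 : antidiagonalSum C (k + 1) = ∑ p ∈ antidiagonal k, C p.1 (p.2 + 1) := by
    rw [antidiagonalSum, Finset.Nat.sum_antidiagonal_succ', h.zero_right, zero_add]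
  have e3 : antidiagonalSum C (k + 2) = ∑ p ∈ antidiagonal k, C (p.1 + 1) (p.2 + 1) := by
    rw [antidiagonalSum, Finset.Nat.sum_antidiagonal_succ, h.zero_left, zero_add,
      Finset.Nat.sum_antidiagonal_succ', h.zero_right, zero_add]
  rw [Finset.sum_add_distrib, Finset.sum_sub_distrib, Finset.sum_sub_distrib, e3, two_mul]
  nth_rewrite 1 [e1]
  rw [e2, antidiagonalSum]
  push_cast
  ring

theorem diff_eq_zero (h : IsCornerSum n C) {i j : ℕ} (hij : ¬(i < n ∧ j < n)) :
    (C (i + 1) (j + 1) : ℤ) - C i (j + 1) - C (i + 1) j + C i j = 0 := by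
  by_cases hi : n ≤ i
  · rw [h.left_full i _ hi, h.left_full i _ hi, h.left_full _ _ (by omega : n ≤ i + 1),
      h.left_full _ _ (by omega : n ≤ i + 1)]
    ring
  · have hj : n ≤ j := by omega
    rw [h.right_full _ j hj, h.right_full _ j hj, h.right_full _ _ (by omega : n ≤ j + 1),
      h.right_full _ _ (by omega : n ≤ j + 1)]
    ring

end IsCornerSum

/-- A sum over the cells of a matrix that lie on an antidiagonal, as a sum over the
antidiagonal. -/
theorem sum_fin_antidiagonal {n : ℕ} (f : ℕ → ℕ → ℤ)
    (hf : ∀ i j, ¬(i < n ∧ j < n) → f i j = 0) (k : ℕ) :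
    ∑ i : Fin n, ∑ j : Fin n, (if (i : ℕ) + (j : ℕ) = k then f i j else 0) =
      ∑ p ∈ antidiagonal k, f p.1 p.2 := by
  rw [Finset.sum_fin_eq_sum_range, ← Finset.sum_filter_of_ne (s := antidiagonal k)
    (p := fun p => p.1 < n ∧ p.2 < n) (fun p _ hp => not_not.mp (mt (hf p.1 p.2) hp))]
  have : Finset.filter (fun p : ℕ × ℕ => p.1 < n ∧ p.2 < n) (antidiagonal k) =
      Finset.filter (fun p : ℕ × ℕ => p.1 + p.2 = k) (Finset.range n ×ˢ Finset.range n) := by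
    ext p
    simp [and_comm]
  rw [this, Finset.sum_filter, Finset.sum_product]
  refine Finset.sum_congr rfl fun i hi => ?_
  rw [dif_pos (Finset.mem_range.mp hi), Finset.sum_fin_eq_sum_range]
  refine Finset.sum_congr rfl fun j hj => ?_
  rw [dif_pos (Finset.mem_range.mp hj)]

namespace IsCornerSum

variable {n : ℕ} {C C' : ℕ → ℕ → ℕ}

theorem xray_diffMatrix (h : IsCornerSum n C) (k : Fin (2 * n - 1)) :
    xray (diffMatrix n C) k =
      antidiagonalSum C (k + 2) - 2 * antidiagonalSum C (k + 1) + antidiagonalSum C k := by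
  rw [← h.sum_antidiagonal_diff, ← sum_fin_antidiagonal
    (fun i j => (C (i + 1) (j + 1) : ℤ) - C i (j + 1) - C (i + 1) j + C i j)
    fun i j hij => h.diff_eq_zero hij]
  rfl

theorem second_difference_eq_zero (h : IsCornerSum n C) (k : ℕ) (hk : 2 * n - 1 ≤ k) :
    (antidiagonalSum C (k + 2) : ℤ) - 2 * antidiagonalSum C (k + 1) + antidiagonalSum C k = 0 := by
  rw [← h.sum_antidiagonal_diff]
  refine Finset.sum_eq_zero fun p hp => h.diff_eq_zero ?_
  rw [Finset.HasAntidiagonal.mem_antidiagonal] at hp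
  omega

/-- The second differences outside the range of the X-ray vanish, and the antidiagonal sums start
with `0, 0`, so the X-ray determines all of them. -/
theorem xray_eq_iff (h : IsCornerSum n C) (h' : IsCornerSum n C') :
    xray (diffMatrix n C) = xray (diffMatrix n C') ↔
      antidiagonalSum C = antidiagonalSum C' := by
  constructor
  · intro e
    have step : ∀ k, (antidiagonalSum C (k + 2) : ℤ) - 2 * antidiagonalSum C (k + 1) +
        antidiagonalSum C k = antidiagonalSum C' (k + 2) - 2 * antidiagonalSum C' (k + 1) +
        antidiagonalSum C' k := by
      intro k
      by_cases hk : k < 2 * n - 1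
      · rw [← h.xray_diffMatrix ⟨k, hk⟩, ← h'.xray_diffMatrix ⟨k, hk⟩, e]
      · rw [h.second_difference_eq_zero k (by omega), h'.second_difference_eq_zero k (by omega)]
    have key : ∀ k, antidiagonalSum C k = antidiagonalSum C' k ∧
        antidiagonalSum C (k + 1) = antidiagonalSum C' (k + 1) := by
      intro k
      induction k with
      | zero =>
        simp [antidiagonalSum, Finset.Nat.sum_antidiagonal_succ, h.zero_left, h.zero_right,
          h'.zero_left, h'.zero_right]
      | succ k ih =>
        have := step k
        refine ⟨ih.2, ?_⟩
        rw [show k + 1 + 1 = k + 2 from rfl]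
        omega
    exact funext fun k => (key k).1
  · intro e
    funext k
    rw [h.xray_diffMatrix, h'.xray_diffMatrix, e]

end IsCornerSum

/-! ### From alternating sign matrices to corner sums -/

/-- The partial sums of an alternating sequence of signs with total `1` are `0` or `1`. -/
theorem sum_range_eq_zero_or_one {n : ℕ} {f : ℕ → ℤ} (h01 : ∀ i, f i = 0 ∨ f i = 1 ∨ f i = -1)
    (hz : ∀ i, n ≤ i → f i = 0) (hs : ∑ i ∈ Finset.range n, f i = 1)
    (ha : ∀ i j, i < j → f i ≠ 0 → f j ≠ 0 → (∀ l, i < l → l < j → f l = 0) → f j = -f i) (j : ℕ) :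
    ∑ i ∈ Finset.range j, f i = 0 ∨ ∑ i ∈ Finset.range j, f i = 1 := by
  classical
  have hne : ∃ a, f a ≠ 0 := by
    by_contra! hne
    simp [hne] at hs
  obtain ⟨a, ha0, hmin⟩ : ∃ a, f a ≠ 0 ∧ ∀ l < a, f l = 0 :=
    ⟨Nat.find hne, Nat.find_spec hne, fun l hl => not_not.mp (Nat.find_min hne hl)⟩
  have han : a < n := by
    by_contra! h
    exact ha0 (hz a h)
  -- With `a` the first and `b` the last nonzero position before `j`, alternation makes the partial
  -- sum the mean of `f a` and `f b`. At `j = n` the total `1` forces `f a = 1`.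
  have key : ∀ j, a < j → ∃ b < j, f b ≠ 0 ∧ (∀ l, b < l → l < j → f l = 0) ∧
      2 * ∑ i ∈ Finset.range j, f i = f a + f b := by
    intro j hj
    induction j, hj using Nat.le_induction with
    | base =>
      refine ⟨a, by omega, ha0, fun l _ _ => by omega, ?_⟩
      rw [Finset.sum_range_succ, Finset.sum_eq_zero fun l hl => hmin l (Finset.mem_range.mp hl)]
      ring
    | succ j hj ih =>
      obtain ⟨b, hb, hb0, hbz, hsum⟩ := ih
      rw [Finset.sum_range_succ, mul_add, hsum]
      by_cases hf : f j = 0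
      · refine ⟨b, by omega, hb0, fun l hl hl' => ?_, by rw [hf]; ring⟩
        rcases Nat.lt_succ_iff_lt_or_eq.mp hl' with h | rfl
        · exact hbz l hl h
        · exact hf
      · refine ⟨j, by omega, hf, fun l _ _ => by omega, ?_⟩
        have := ha b j hb hb0 hf hbz
        omega
  have hfa : f a = 1 := by
    obtain ⟨b, -, -, -, h⟩ := key n han
    have := h01 a
    have := h01 b
    omega
  by_cases hj : a < j
  · obtain ⟨b, -, -, -, h⟩ := key j hj
    have := h01 b
    omega
  · left
    exact Finset.sum_eq_zero fun l hl => hmin l (by have := Finset.mem_range.mp hl; omega)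

/-- A matrix, extended by zero. -/
def extendByZero {n : ℕ} (A : Matrix (Fin n) (Fin n) ℤ) (i j : ℕ) : ℤ :=
  if h : i < n ∧ j < n then A ⟨i, h.1⟩ ⟨j, h.2⟩ else 0

theorem extendByZero_transpose {n : ℕ} (A : Matrix (Fin n) (Fin n) ℤ) (i j : ℕ) :
    extendByZero A.transpose i j = extendByZero A j i := by
  simp only [extendByZero, and_comm, Matrix.transpose_apply]

theorem IsASM.transpose {n : ℕ} {A : Matrix (Fin n) (Fin n) ℤ} (h : IsASM A) :
    IsASM A.transpose :=
  ⟨fun i j => h.entries j i, h.col_sum, h.row_sum, h.col_alternates, h.row_alternates⟩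

theorem IsASM.sum_range_row {n : ℕ} {A : Matrix (Fin n) (Fin n) ℤ} (h : IsASM A) {i : ℕ}
    (hi : i < n) : ∑ l ∈ Finset.range n, extendByZero A i l = 1 := by
  rw [← h.row_sum ⟨i, hi⟩, Finset.sum_range]
  exact Finset.sum_congr rfl fun l _ => dif_pos ⟨hi, l.isLt⟩

theorem IsASM.sum_row_eq_zero_or_one {n : ℕ} {A : Matrix (Fin n) (Fin n) ℤ} (h : IsASM A)
    (i j : ℕ) : ∑ l ∈ Finset.range j, extendByZero A i l = 0 ∨
      ∑ l ∈ Finset.range j, extendByZero A i l = 1 := by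
  by_cases hi : i < n
  · have e : ∀ l (hl : l < n), extendByZero A i l = A ⟨i, hi⟩ ⟨l, hl⟩ :=
      fun l hl => dif_pos ⟨hi, hl⟩
    have hz : ∀ l, n ≤ l → extendByZero A i l = 0 := fun l hl => dif_neg (by omega)
    refine sum_range_eq_zero_or_one ?_ hz (h.sum_range_row hi) ?_ j
    · intro l
      by_cases hl : l < n
      · rw [e l hl]
        exact h.entries _ _
      · exact Or.inl (hz l (by omega))
    · intro l l' hll h0 h1 hb
      have hl' : l' < n := by
        by_contra! hl'
        exact h1 (hz l' hl')
      have hl : l < n := hll.trans hl'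
      rw [e l hl] at h0
      rw [e l' hl'] at h1
      rw [e l hl, e l' hl']
      refine h.row_alternates _ _ _ hll h0 h1 fun k hk hk' => ?_
      rw [← hb k hk hk', e k k.isLt]
  · left
    exact Finset.sum_eq_zero fun l _ => dif_neg (by omega)

/-- The sum of the entries in the first `i` rows and the first `j` columns. -/
def cornerSum {n : ℕ} (A : Matrix (Fin n) (Fin n) ℤ) (i j : ℕ) : ℤ :=
  ∑ k ∈ Finset.range i, ∑ l ∈ Finset.range j, extendByZero A k l

theorem cornerSum_transpose {n : ℕ} (A : Matrix (Fin n) (Fin n) ℤ) (i j : ℕ) :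
    cornerSum A.transpose i j = cornerSum A j i := by
  simp only [cornerSum, extendByZero_transpose]
  exact Finset.sum_comm

theorem IsASM.cornerSum_succ {n : ℕ} {A : Matrix (Fin n) (Fin n) ℤ} (h : IsASM A) (i j : ℕ) :
    cornerSum A (i + 1) j = cornerSum A i j ∨ cornerSum A (i + 1) j = cornerSum A i j + 1 := by
  rw [cornerSum, Finset.sum_range_succ]
  rcases h.sum_row_eq_zero_or_one i j with e | e <;> simp [e, cornerSum]

theorem IsASM.cornerSum_nonneg {n : ℕ} {A : Matrix (Fin n) (Fin n) ℤ} (h : IsASM A) (i j : ℕ) :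
    0 ≤ cornerSum A i j := by
  refine Finset.sum_nonneg fun k _ => ?_
  rcases h.sum_row_eq_zero_or_one k j with e | e <;> simp [e]

theorem IsASM.cornerSum_of_size_le {n : ℕ} {A : Matrix (Fin n) (Fin n) ℤ} (h : IsASM A) (i j : ℕ)
    (hj : n ≤ j) : cornerSum A i j = min i n := by
  have hrow : ∀ k, ∑ l ∈ Finset.range j, extendByZero A k l = if k < n then 1 else 0 := by
    intro k
    rw [← Finset.sum_subset (Finset.range_subset_range.mpr hj)]
    · split_ifs with hk
      · exact h.sum_range_row hk
      · exact Finset.sum_eq_zero fun l _ => dif_neg (by omega)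
    · intro l _ hl
      rw [Finset.mem_range] at hl
      exact dif_neg (by omega)
  simp only [cornerSum, hrow]
  rw [Finset.sum_ite, Finset.sum_const_zero, add_zero, Finset.sum_const, nsmul_one]
  have : Finset.filter (fun k => k < n) (Finset.range i) = Finset.range (min i n) := by
    ext k
    simp
  rw [this, Finset.card_range]

theorem IsASM.exists_eq_diffMatrix {n : ℕ} {A : Matrix (Fin n) (Fin n) ℤ} (h : IsASM A) :
    ∃ C, IsCornerSum n C ∧ diffMatrix n C = A := by
  have hcast : ∀ i j, ((cornerSum A i j).toNat : ℤ) = cornerSum A i j :=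
    fun i j => Int.toNat_of_nonneg (h.cornerSum_nonneg i j)
  have hcol : ∀ i j, cornerSum A i (j + 1) = cornerSum A i j ∨
      cornerSum A i (j + 1) = cornerSum A i j + 1 := by
    intro i j
    simp only [← cornerSum_transpose A _ i]
    exact h.transpose.cornerSum_succ j i
  refine ⟨fun i j => (cornerSum A i j).toNat, ⟨?_, ?_, ?_, ?_, ?_, ?_, ?_, ?_⟩, ?_⟩
  · intro j
    simp [cornerSum]
  · intro i
    simp [cornerSum]
  · intro i j
    have := h.cornerSum_succ i j
    omega
  · intro i j
    have := h.cornerSum_succ i j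
    omega
  · intro i j
    have := hcol i j
    omega
  · intro i j
    have := hcol i j
    omega
  · intro i j hi
    have := h.transpose.cornerSum_of_size_le j i hi
    rw [cornerSum_transpose] at this
    omega
  · intro i j hj
    have := h.cornerSum_of_size_le i j hj
    omega
  · have key : ∀ i j, cornerSum A (i + 1) (j + 1) - cornerSum A i (j + 1) - cornerSum A (i + 1) j +
        cornerSum A i j = extendByZero A i j := by
      intro i j
      simp only [cornerSum, Finset.sum_range_succ]
      ring
    funext i j
    simp only [diffMatrix, hcast, key]
    exact dif_pos ⟨i.isLt, j.isLt⟩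

/-! ### Level sets on antidiagonals -/

/-- The number of cells of the antidiagonal `m` where `C` is at least `t`. -/
def levelCard (C : ℕ → ℕ → ℕ) (t m : ℕ) : ℕ :=
  ((antidiagonal m).filter fun p => t ≤ C p.1 p.2).card

theorem levelCard_pos {C : ℕ → ℕ → ℕ} {t i j : ℕ} (h : t ≤ C i j) : 0 < levelCard C t (i + j) :=
  Finset.card_pos.mpr ⟨(i, j), by simpa using h⟩

theorem levelCard_zero (C : ℕ → ℕ → ℕ) (m : ℕ) : levelCard C 0 m = m + 1 := by
  simp [levelCard]

/-- Along an antidiagonal, the sum is the sum of the sizes of the level sets. -/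
theorem antidiagonalSum_eq_sum_levelCard {C : ℕ → ℕ → ℕ} (hC : ∀ i j, C i j ≤ i) (m : ℕ) :
    antidiagonalSum C m = ∑ t ∈ Finset.range m, levelCard C (t + 1) m := by
  simp only [antidiagonalSum, levelCard, Finset.card_filter]
  rw [Finset.sum_comm]
  refine Finset.sum_congr rfl fun p hp => ?_
  rw [← Finset.card_filter]
  have := hC p.1 p.2
  rw [Finset.HasAntidiagonal.mem_antidiagonal] at hp
  have : Finset.filter (fun t => t + 1 ≤ C p.1 p.2) (Finset.range m) =
      Finset.range (C p.1 p.2) := by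
    ext t
    simp
    omega
  rw [this, Finset.card_range]

namespace IsCornerSum

variable {n : ℕ} {C : ℕ → ℕ → ℕ}

/-- Moving the level set one row down stays in the level by monotonicity; its rightmost cell moved
right instead is one cell more. -/
theorem levelCard_lt_succ (h : IsCornerSum n C) {t m : ℕ} (hpos : 0 < levelCard C t m) :
    levelCard C t m < levelCard C t (m + 1) := by
  set s := (antidiagonal m).filter fun p => t ≤ C p.1 p.2 with hs
  have hne : s.Nonempty := Finset.card_pos.mp hpos
  obtain ⟨q, hq, hmax⟩ := s.exists_max_image (fun p => p.2) hne
  have hinj : Function.Injective fun p : ℕ × ℕ => (p.1 + 1, p.2) := by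
    rintro ⟨a, b⟩ ⟨c, d⟩ hcd
    simpa using hcd
  have hnot : (q.1, q.2 + 1) ∉ s.image fun p => (p.1 + 1, p.2) := by
    intro hmem
    obtain ⟨p, hp, hpq⟩ := Finset.mem_image.mp hmem
    have := hmax p hp
    rw [Prod.mk.injEq] at hpq
    omega
  have hsub : insert (q.1, q.2 + 1) (s.image fun p => (p.1 + 1, p.2)) ⊆
      (antidiagonal (m + 1)).filter fun p => t ≤ C p.1 p.2 := by
    intro p hp
    rcases Finset.mem_insert.mp hp with rfl | hp
    · simp only [hs, Finset.mem_filter, Finset.HasAntidiagonal.mem_antidiagonal] at hq ⊢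
      exact ⟨by omega, hq.2.trans (h.le_right _ _)⟩
    · obtain ⟨r, hr, rfl⟩ := Finset.mem_image.mp hp
      simp only [hs, Finset.mem_filter, Finset.HasAntidiagonal.mem_antidiagonal] at hr ⊢
      exact ⟨by omega, hr.2.trans (h.le_left _ _)⟩
  have := Finset.card_le_card hsub
  rw [Finset.card_insert_of_notMem hnot, Finset.card_image_of_injective _ hinj] at this
  exact this

/-- Moving one row up lowers `C` by at most `1`; the lowest cell moved left instead is one cell
more. -/
theorem levelCard_succ_lt (h : IsCornerSum n C) {t m : ℕ}
    (hpos : 0 < levelCard C (t + 1) (m + 1)) :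
    levelCard C (t + 1) (m + 1) < levelCard C t m := by
  set s := (antidiagonal (m + 1)).filter fun p => t + 1 ≤ C p.1 p.2 with hs
  have hmem : ∀ p ∈ s, p.1 + p.2 = m + 1 ∧ t + 1 ≤ C p.1 p.2 ∧ 0 < p.1 ∧ 0 < p.2 := by
    intro p hp
    simp only [hs, Finset.mem_filter, Finset.HasAntidiagonal.mem_antidiagonal] at hp
    have := h.le_fst p.1 p.2
    have := h.le_snd p.1 p.2
    exact ⟨hp.1, hp.2, by omega, by omega⟩
  have hne : s.Nonempty := Finset.card_pos.mp hpos
  obtain ⟨q, hq, hmax⟩ := s.exists_max_image (fun p => p.1) hne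
  have hinj : Set.InjOn (fun p : ℕ × ℕ => (p.1 - 1, p.2)) s := by
    intro p hp r hr hpr
    have := hmem p hp
    have := hmem r hr
    simp only [Prod.mk.injEq] at hpr
    exact Prod.ext (by omega) (by omega)
  have hnot : (q.1, q.2 - 1) ∉ s.image fun p => (p.1 - 1, p.2) := by
    intro hmem'
    obtain ⟨p, hp, hpq⟩ := Finset.mem_image.mp hmem'
    have := hmax p hp
    have := hmem p hp
    rw [Prod.mk.injEq] at hpq
    omega
  have hsub : insert (q.1, q.2 - 1) (s.image fun p => (p.1 - 1, p.2)) ⊆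
      (antidiagonal m).filter fun p => t ≤ C p.1 p.2 := by
    intro p hp
    simp only [Finset.mem_filter, Finset.HasAntidiagonal.mem_antidiagonal]
    rcases Finset.mem_insert.mp hp with rfl | hp
    · have := hmem q hq
      have := h.right_le q.1 (q.2 - 1)
      rw [show q.2 - 1 + 1 = q.2 by omega] at this
      exact ⟨by simp only; omega, by simp only; omega⟩
    · obtain ⟨r, hr, rfl⟩ := Finset.mem_image.mp hp
      have := hmem r hr
      have := h.left_le (r.1 - 1) r.2
      rw [show r.1 - 1 + 1 = r.1 by omega] at this
      exact ⟨by simp only; omega, by simp only; omega⟩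
  have := Finset.card_le_card hsub
  rw [Finset.card_insert_of_notMem hnot, Finset.card_image_of_injOn hinj] at this
  exact this

/-- The two strict inequalities together cost two cells per level. Hence the pushed level `t` fits
into the rows `t, ..., m - t`. -/
theorem add_two_mul_levelCard_le (h : IsCornerSum n C) (t m : ℕ) (hpos : 0 < levelCard C t m) :
    levelCard C t m + 2 * t ≤ m + 1 := by
  induction t with
  | zero => simp [levelCard_zero]
  | succ t ih =>
    have h1 := h.levelCard_lt_succ hpos
    have h2 := h.levelCard_succ_lt (hpos.trans h1)
    have := ih (by omega)
    omega

theorem levelCard_eq_zero (h : IsCornerSum n C) {t : ℕ} (ht : n < t) (m : ℕ) :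
    levelCard C t m = 0 := by
  refine Finset.card_eq_zero.mpr (Finset.filter_eq_empty_iff.mpr fun p _ => ?_)
  have := h.le_size p.1 p.2
  omega

/-! ### Pushing the level sets to the top right -/

/-- The cell in row `i` of the antidiagonal `m` belongs to the level set `t` once all level sets
have been pushed to the top right. -/
def _root_.PushedLevel (C : ℕ → ℕ → ℕ) (t i m : ℕ) : Prop := t ≤ i ∧ i < t + levelCard C t m

theorem pushedLevel_of_succ (h : IsCornerSum n C) {t i m : ℕ} (hp : PushedLevel C (t + 1) i m) :
    PushedLevel C t i m := by
  obtain ⟨h1, h2⟩ := hp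
  have h3 := h.levelCard_lt_succ (t := t + 1) (m := m) (by omega)
  have h4 := h.levelCard_succ_lt (t := t) (m := m) (by omega)
  exact ⟨by omega, by omega⟩

theorem pushedLevel_antitone (h : IsCornerSum n C) {s t i m : ℕ} (hst : s ≤ t)
    (hp : PushedLevel C t i m) : PushedLevel C s i m := by
  induction t, hst using Nat.le_induction with
  | base => exact hp
  | succ t _ ih => exact ih (h.pushedLevel_of_succ hp)

/-- The pushed level sets are nested, so they are the level sets of a function: the largest `t`
whose pushed level contains the cell. -/
theorem exists_pushed (h : IsCornerSum n C) :
    ∃ L : ℕ → ℕ → ℕ, ∀ i j t, t ≤ L i j ↔ PushedLevel C t i (i + j) := by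
  classical
  refine ⟨fun i j => Nat.findGreatest (fun t => PushedLevel C t i (i + j)) i, fun i j t => ?_⟩
  have h0 : PushedLevel C 0 i (i + j) := ⟨by omega, by rw [levelCard_zero]; omega⟩
  constructor
  · intro ht
    exact h.pushedLevel_antitone ht
      (Nat.findGreatest_spec (P := fun t => PushedLevel C t i (i + j)) (Nat.zero_le i) h0)
  · intro ht
    exact Nat.le_findGreatest ht.1 ht

/-- Here `i + j ≥ n + t`, so `add_le` puts every inner cell in rows `t, ..., i + j - t` into the
level; outer cells have known values. -/
theorem levelCard_full (h : IsCornerSum n C) {t i j : ℕ} (hij : n ≤ i ∨ n ≤ j) (hi : t ≤ i)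
    (hj : t ≤ j) (hn : t ≤ n) : i + j + 1 ≤ levelCard C t (i + j) + 2 * t := by
  have hinj : Set.InjOn (fun k => (k, i + j - k)) (Finset.Icc t (i + j - t)) := by
    intro a _ b _ hab
    exact (Prod.mk.inj hab).1
  have hsub : (Finset.Icc t (i + j - t)).image (fun k => (k, i + j - k)) ⊆
      (antidiagonal (i + j)).filter fun p => t ≤ C p.1 p.2 := by
    intro p hp
    obtain ⟨k, hk, rfl⟩ := Finset.mem_image.mp hp
    rw [Finset.mem_Icc] at hk
    simp only [Finset.mem_filter, Finset.HasAntidiagonal.mem_antidiagonal]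
    refine ⟨by omega, ?_⟩
    by_cases h1 : n ≤ k
    · rw [h.left_full _ _ h1]
      omega
    · by_cases h2 : n ≤ i + j - k
      · rw [h.right_full _ _ h2]
        omega
      · have := h.add_le k (i + j - k) (by omega) (by omega)
        omega
  have := Finset.card_le_card hsub
  rw [Finset.card_image_of_injOn hinj, Nat.card_Icc] at this
  rw [levelCard]
  omega

/-- The step conditions restate the two inequalities between level sizes. Strictness is needed for
monotonicity down a column and for the bound on a step to the right. -/
theorem isCornerSum_pushed (h : IsCornerSum n C) {L : ℕ → ℕ → ℕ}
    (hL : ∀ i j t, t ≤ L i j ↔ PushedLevel C t i (i + j)) : IsCornerSum n L := by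
  have hself : ∀ i j, PushedLevel C (L i j) i (i + j) := fun i j => (hL i j _).mp le_rfl
  have hfst : ∀ i j, L i j ≤ i := fun i j => (hself i j).1
  have hsnd : ∀ i j, L i j ≤ j := by
    intro i j
    obtain ⟨h1, h2⟩ := hself i j
    have := h.add_two_mul_levelCard_le (L i j) (i + j) (by omega)
    omega
  have hsize : ∀ i j, L i j ≤ n := by
    intro i j
    obtain ⟨h1, h2⟩ := hself i j
    by_contra! hn
    have := h.levelCard_eq_zero hn (i + j)
    omega
  have hfull : ∀ i j, n ≤ i ∨ n ≤ j → min (min i j) n ≤ L i j := by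
    intro i j hij
    have := h.levelCard_full (t := min (min i j) n) hij (by omega) (by omega) (by omega)
    exact (hL i j _).mpr ⟨by omega, by omega⟩
  refine ⟨fun j => ?_, fun i => ?_, fun i j => ?_, fun i j => ?_, fun i j => ?_, fun i j => ?_,
    fun i j hi => ?_, fun i j hj => ?_⟩
  · exact Nat.le_zero.mp (hfst 0 j)
  · exact Nat.le_zero.mp (hsnd i 0)
  · obtain ⟨h1, h2⟩ := hself i j
    rw [hL, show i + 1 + j = i + j + 1 by omega]
    have := h.levelCard_lt_succ (t := L i j) (m := i + j) (by omega)
    exact ⟨by omega, by omega⟩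
  · have hp := hself (i + 1) j
    rcases Nat.eq_zero_or_pos (L (i + 1) j) with h0 | h0
    · omega
    · obtain ⟨t, ht⟩ : ∃ t, L (i + 1) j = t + 1 := ⟨_, (Nat.succ_pred_eq_of_pos h0).symm⟩
      rw [ht, show i + 1 + j = i + j + 1 by omega] at hp
      obtain ⟨h1, h2⟩ := hp
      have := h.levelCard_succ_lt (t := t) (m := i + j) (by omega)
      rw [ht, Nat.succ_le_succ_iff, hL]
      exact ⟨by omega, by omega⟩
  · obtain ⟨h1, h2⟩ := hself i j
    rw [hL, ← add_assoc]
    have := h.levelCard_lt_succ (t := L i j) (m := i + j) (by omega)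
    exact ⟨by omega, by omega⟩
  · have hp := hself i (j + 1)
    rcases Nat.eq_zero_or_pos (L i (j + 1)) with h0 | h0
    · omega
    · obtain ⟨t, ht⟩ : ∃ t, L i (j + 1) = t + 1 := ⟨_, (Nat.succ_pred_eq_of_pos h0).symm⟩
      rw [ht, ← add_assoc] at hp
      obtain ⟨h1, h2⟩ := hp
      have := h.levelCard_succ_lt (t := t) (m := i + j) (by omega)
      rw [ht, Nat.succ_le_succ_iff, hL]
      exact ⟨by omega, by omega⟩
  · have := hfull i j (Or.inl hi)
    have := hsnd i j
    have := hsize i j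
    omega
  · have := hfull i j (Or.inr hj)
    have := hfst i j
    have := hsize i j
    omega

theorem levelCard_pushed (h : IsCornerSum n C) {L : ℕ → ℕ → ℕ}
    (hL : ∀ i j t, t ≤ L i j ↔ PushedLevel C t i (i + j)) (t m : ℕ) :
    levelCard L t m = levelCard C t m := by
  have hinj : Set.InjOn (fun k => (k, m - k)) (Finset.Ico t (t + levelCard C t m)) := by
    intro a _ b _ hab
    exact (Prod.mk.inj hab).1
  have : ((antidiagonal m).filter fun p => t ≤ L p.1 p.2) =
      (Finset.Ico t (t + levelCard C t m)).image fun k => (k, m - k) := by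
    ext ⟨i, j⟩
    simp only [Finset.mem_filter, Finset.HasAntidiagonal.mem_antidiagonal, Finset.mem_image,
      Finset.mem_Ico, Prod.mk.injEq, hL, PushedLevel]
    constructor
    · rintro ⟨rfl, h1⟩
      exact ⟨i, h1, rfl, by omega⟩
    · rintro ⟨k, ⟨h1, h2⟩, rfl, rfl⟩
      have := h.add_two_mul_levelCard_le t m (by omega)
      have hm : k + (m - k) = m := by omega
      exact ⟨hm, h1, by rwa [hm]⟩
  rw [levelCard, this, Finset.card_image_of_injOn hinj, Nat.card_Ico]
  omega

theorem antidiagonalSum_pushed (h : IsCornerSum n C) {L : ℕ → ℕ → ℕ}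
    (hL : ∀ i j t, t ≤ L i j ↔ PushedLevel C t i (i + j)) :
    antidiagonalSum L = antidiagonalSum C := by
  funext m
  rw [antidiagonalSum_eq_sum_levelCard h.le_fst,
    antidiagonalSum_eq_sum_levelCard (h.isCornerSum_pushed hL).le_fst]
  exact Finset.sum_congr rfl fun t _ => h.levelCard_pushed hL _ m

/-- A corner sum that is determined by its antidiagonal sums is constant in the middle of every
antidiagonal. -/
theorem eq_min_of_unique (h : IsCornerSum n C)
    (hu : ∀ C', IsCornerSum n C' → antidiagonalSum C' = antidiagonalSum C → C' = C) (i j : ℕ) :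
    C i j = min (min i j) (C ((i + j) / 2) (i + j - (i + j) / 2)) := by
  obtain ⟨L, hL⟩ := h.exists_pushed
  have hLC : L = C := hu L (h.isCornerSum_pushed hL) (h.antidiagonalSum_pushed hL)
  rw [hLC] at hL
  have hsymm : ∀ i j, C i j = C j i := fun i j =>
    congrFun (congrFun (hu _ h.transpose (antidiagonalSum_transpose C)) j) i
  -- A nonempty pushed level contains its top cell `(t, m - t)`, with `m = i + j`, hence by symmetry
  -- the mirror cell `(m - t, t)`, and so every row between.
  have hfull : ∀ i j t, t ≤ C i j → i + j + 1 ≤ levelCard C t (i + j) + 2 * t := by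
    intro i j t ht
    have hpos := levelCard_pos ht
    have h2 := h.add_two_mul_levelCard_le t (i + j) hpos
    have h1 : t ≤ C t (i + j - t) := by
      rw [hL, show t + (i + j - t) = i + j by omega]
      exact ⟨le_rfl, by omega⟩
    rw [hsymm, hL, show i + j - t + t = i + j by omega] at h1
    have := h1.2
    omega
  have hm : (i + j) / 2 + (i + j - (i + j) / 2) = i + j := by omega
  have hi := h.le_fst i j
  have hj := h.le_snd i j
  apply le_antisymm
  · refine le_min (le_min hi hj) ?_
    have := hfull i j _ le_rfl
    rw [hL, hm]
    exact ⟨by omega, by omega⟩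
  · set c := C ((i + j) / 2) (i + j - (i + j) / 2) with hc
    have := hfull ((i + j) / 2) (i + j - (i + j) / 2) (min (min i j) c) (min_le_right _ _)
    rw [hm] at this
    rw [hL]
    exact ⟨by omega, by omega⟩

end IsCornerSum

/-! ### Dyck paths and their corner sums -/

namespace DyckPath

theorem south_succ (p : DyckWord) (k : ℕ) :
    south p (k + 1) = south p k + if p.toList[k]? = some DyckStep.D then 1 else 0 := by
  rw [south, List.take_add_one, List.count_append, south]
  congr 1
  rcases hk : p.toList[k]? with _ | s
  · simp
  · cases s <;> simp

theorem east_add_south (p : DyckWord) (k : ℕ) :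
    east p k + south p k = min k p.toList.length := by
  rw [← List.length_take, east, south]
  generalize p.toList.take k = l
  induction l with
  | nil => simp
  | cons s l ih => cases s <;> simp <;> omega

theorem length_eq {n : ℕ} {p : DyckWord} (hp : p.semilength = n) : p.toList.length = 2 * n := by
  rw [← hp, p.two_mul_semilength_eq_length]

theorem two_mul_south_le (p : DyckWord) (k : ℕ) : 2 * south p k ≤ k := by
  have h1 := east_add_south p k
  have h2 : south p k ≤ east p k := p.count_D_le_count_U k
  omega

theorem south_le {n : ℕ} {p : DyckWord} (hp : p.semilength = n) (k : ℕ) : south p k ≤ n := by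
  rw [← hp, p.semilength_eq_count_D]
  exact (List.take_sublist k _).count_le _

theorem south_of_le {n : ℕ} {p : DyckWord} (hp : p.semilength = n) {k : ℕ} (hk : 2 * n ≤ k) :
    south p k = n := by
  rw [← hp, p.semilength_eq_count_D, south, List.take_of_length_le]
  rwa [length_eq hp]

theorem le_south_add {n : ℕ} {p : DyckWord} (hp : p.semilength = n) {k : ℕ} (hk : k ≤ 2 * n) :
    k ≤ south p k + n := by
  have h1 := east_add_south p k
  have h2 : east p k ≤ n := by
    rw [← hp, DyckWord.semilength]
    exact (List.take_sublist k _).count_le _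
  rw [length_eq hp] at h1
  omega

theorem south_succ_cases (p : DyckWord) (k : ℕ) :
    south p (k + 1) = south p k ∨ south p (k + 1) = south p k + 1 := by
  rw [south_succ]
  split_ifs <;> simp

theorem getElem?_eq_D_iff (p : DyckWord) (k : ℕ) :
    p.toList[k]? = some DyckStep.D ↔ south p (k + 1) = south p k + 1 := by
  rw [south_succ]
  split_ifs with h <;> simp [h]

theorem getElem?_eq_U_iff (p : DyckWord) {k : ℕ} (hk : k < p.toList.length) :
    p.toList[k]? = some DyckStep.U ↔ south p (k + 1) = south p k := by
  rw [south_succ, List.getElem?_eq_getElem hk]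
  rcases p.toList[k] with _ | _ <;> simp

theorem eq_of_south_eq {n : ℕ} {p q : DyckWord} (hp : p.semilength = n) (hq : q.semilength = n)
    (h : ∀ k, south p k = south q k) : p = q := by
  refine DyckWord.ext (List.ext_getElem? fun k => ?_)
  by_cases hk : k < 2 * n
  · have hpk : k < p.toList.length := by rwa [length_eq hp]
    have hqk : k < q.toList.length := by rwa [length_eq hq]
    have hD := getElem?_eq_D_iff p k
    rw [h, h, ← getElem?_eq_D_iff q k] at hD
    rw [List.getElem?_eq_getElem hpk, List.getElem?_eq_getElem hqk] at hD ⊢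
    revert hD
    rcases p.toList[k] with _ | _ <;> rcases q.toList[k] with _ | _ <;> simp
  · rw [List.getElem?_eq_none (by rw [length_eq hp]; omega),
      List.getElem?_eq_none (by rw [length_eq hq]; omega)]

/-- The corner sums of the matrix of a Dyck path. -/
def cornerSum (p : DyckWord) (i j : ℕ) : ℕ := min (min i j) (south p (i + j))

theorem isCornerSum {n : ℕ} {p : DyckWord} (hp : p.semilength = n) :
    IsCornerSum n (cornerSum p) := by
  have step := south_succ_cases p
  refine ⟨fun j => ?_, fun i => ?_, fun i j => ?_, fun i j => ?_, fun i j => ?_, fun i j => ?_,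
    fun i j hi => ?_, fun i j hj => ?_⟩ <;> simp only [cornerSum]
  · simp
  · simp
  · have := step (i + j)
    rw [show i + 1 + j = i + j + 1 by omega]
    omega
  · have := step (i + j)
    rw [show i + 1 + j = i + j + 1 by omega]
    omega
  · have := step (i + j)
    rw [← add_assoc]
    omega
  · have := step (i + j)
    rw [← add_assoc]
    omega
  all_goals
    have := south_le hp (i + j)
    rcases le_total (i + j) (2 * n) with h | h
    · have := le_south_add hp h
      omega
    · have := south_of_le hp h
      omega

theorem cornerSum_second_difference (p : DyckWord) (i j : ℕ) :
    (cornerSum p (i + 1) (j + 1) : ℤ) - cornerSum p i (j + 1) - cornerSum p (i + 1) j +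
      cornerSum p i j =
    if (south p (i + j + 1) = south p (i + j) ∧ south p (i + j + 2) = south p (i + j + 1) + 1) ∧
        south p (i + j + 1) ≤ i ∧ south p (i + j + 1) ≤ j then 1
    else if
      (south p (i + j + 1) = south p (i + j) + 1 ∧ south p (i + j + 2) = south p (i + j + 1)) ∧
        south p (i + j + 1) ≤ i ∧ south p (i + j + 1) ≤ j then -1
    else 0 := by
  have s0 := south_succ_cases p (i + j)
  have s1 : south p (i + j + 2) = _ ∨ south p (i + j + 2) = _ := south_succ_cases p (i + j + 1)
  have d1 := two_mul_south_le p (i + j + 1)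
  simp only [cornerSum]
  rw [show i + 1 + (j + 1) = i + j + 2 by omega, show i + (j + 1) = i + j + 1 by omega,
    show i + 1 + j = i + j + 1 by omega]
  generalize south p (i + j) = a at *
  generalize south p (i + j + 1) = b at *
  generalize south p (i + j + 2) = c at *
  -- In the first case all four minima equal values of `south`; otherwise they are governed by the
  -- smaller of `i` and `j`, and the differences cancel.
  by_cases hij : b ≤ i ∧ b ≤ j
  · have e1 : min (min (i + 1) (j + 1)) c = c := by omega
    have e2 : min (min i (j + 1)) b = b := by omega
    have e3 : min (min (i + 1) j) b = b := by omega
    have e4 : min (min i j) a = a := by omega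
    rw [e1, e2, e3, e4]
    rcases s0 with rfl | rfl <;> rcases s1 with rfl | rfl <;> simp [hij]
  · rw [if_neg fun h => hij h.2, if_neg fun h => hij h.2]
    rcases lt_trichotomy i j with h | h | h
    · have e1 : min (min (i + 1) (j + 1)) c = i + 1 := by omega
      have e2 : min (min i (j + 1)) b = i := by omega
      have e3 : min (min (i + 1) j) b = i + 1 := by omega
      have e4 : min (min i j) a = i := by omega
      rw [e1, e2, e3, e4]
      omega
    -- For `i = j` the Dyck condition `2 * b ≤ 2 * i + 1` gives `b ≤ i`, contrary to `hij`.
    · omega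
    · have e1 : min (min (i + 1) (j + 1)) c = j + 1 := by omega
      have e2 : min (min i (j + 1)) b = j + 1 := by omega
      have e3 : min (min (i + 1) j) b = j := by omega
      have e4 : min (min i j) a = j := by omega
      rw [e1, e2, e3, e4]
      omega

theorem toMatrix_eq_diffMatrix {n : ℕ} {p : DyckWord} (hp : p.semilength = n) :
    toMatrix n p = diffMatrix n (cornerSum p) := by
  funext i j
  obtain ⟨i, hi⟩ := i
  obtain ⟨j, hj⟩ := j
  have hlen := length_eq hp
  have hk : i + j + 1 < p.toList.length := by omega
  have hcell : ∀ k, k < p.toList.length →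
      (CellBetween (south p (k + 1)) (east p (k + 1)) i j ↔
        k = i + j ∧ south p (i + j + 1) ≤ i ∧ south p (i + j + 1) ≤ j) := by
    intro k hk
    have h1 := east_add_south p (k + 1)
    simp only [CellBetween]
    constructor
    · rintro ⟨h2, h3, h4⟩
      obtain rfl : k = i + j := by omega
      exact ⟨rfl, by omega, by omega⟩
    · rintro ⟨rfl, h3, h4⟩
      exact ⟨by omega, by omega, by omega⟩
  have hpeak : (∃ k ∈ peaks p, CellBetween (south p (k + 1)) (east p (k + 1)) i j) ↔
      (south p (i + j + 1) = south p (i + j) ∧ south p (i + j + 2) = south p (i + j + 1) + 1) ∧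
        south p (i + j + 1) ≤ i ∧ south p (i + j + 1) ≤ j := by
    simp only [peaks, Finset.mem_filter, Finset.mem_range]
    rw [← getElem?_eq_U_iff p (by omega : i + j < p.toList.length), ← getElem?_eq_D_iff]
    constructor
    · rintro ⟨k, ⟨h1, h2⟩, h3⟩
      obtain ⟨rfl, h4⟩ := (hcell k h1).mp h3
      exact ⟨h2, h4⟩
    · rintro ⟨h2, h4⟩
      exact ⟨i + j, ⟨by omega, h2⟩, (hcell _ (by omega)).mpr ⟨rfl, h4⟩⟩
  have hvalley : (∃ k ∈ valleys p, CellBetween (south p (k + 1)) (east p (k + 1)) i j) ↔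
      (south p (i + j + 1) = south p (i + j) + 1 ∧ south p (i + j + 2) = south p (i + j + 1)) ∧
        south p (i + j + 1) ≤ i ∧ south p (i + j + 1) ≤ j := by
    simp only [valleys, Finset.mem_filter, Finset.mem_range]
    rw [← getElem?_eq_U_iff p hk, ← getElem?_eq_D_iff]
    constructor
    · rintro ⟨k, ⟨h1, h2⟩, h3⟩
      obtain ⟨rfl, h4⟩ := (hcell k h1).mp h3
      exact ⟨h2, h4⟩
    · rintro ⟨h2, h4⟩
      exact ⟨i + j, ⟨by omega, h2⟩, (hcell _ (by omega)).mpr ⟨rfl, h4⟩⟩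
  rw [toMatrix, diffMatrix, cornerSum_second_difference p i j]
  exact if_congr hpeak rfl (if_congr hvalley rfl rfl)

/-! ### Uniqueness, and reconstruction of the path -/

/-- The corner sums of a Dyck path are determined by their antidiagonal sums. -/
theorem cornerSum_unique {n : ℕ} {p : DyckWord} (hp : p.semilength = n) {C : ℕ → ℕ → ℕ}
    (h : IsCornerSum n C) (hs : antidiagonalSum C = antidiagonalSum (cornerSum p)) :
    C = cornerSum p := by
  have key : ∀ m i j, i + j = m → C i j = cornerSum p i j := by
    intro m
    induction m with
    | zero =>
      intro i j hij
      obtain rfl : i = 0 := by omega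
      rw [h.zero_left, (isCornerSum hp).zero_left]
    | succ m ih =>
      have hcmp : (∀ q ∈ antidiagonal (m + 1), C q.1 q.2 ≤ cornerSum p q.1 q.2) ∨
          ∀ q ∈ antidiagonal (m + 1), cornerSum p q.1 q.2 ≤ C q.1 q.2 := by
        have hd := two_mul_south_le p m
        rcases south_succ_cases p m with hm | hm
        -- East step: monotonicity from the cells above and to the left gives the lower bound. As `2
        -- * south p m ≤ m`, the indices `i` and `j` are not both at most `south p m`, so one of
        -- these two cells suffices.
        · right
          rintro ⟨i, j⟩ hq
          rw [Finset.HasAntidiagonal.mem_antidiagonal] at hq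
          simp only at hq ⊢
          have hi := h.le_left (i - 1) j
          have hj := h.le_right i (j - 1)
          have ihi := ih (i - 1) j
          have ihj := ih i (j - 1)
          simp only [cornerSum, hq] at ihi ihj ⊢
          by_cases hi0 : i = 0
          · omega
          by_cases hj0 : j = 0
          · omega
          rw [show i - 1 + j = m by omega] at ihi
          rw [show i + (j - 1) = m by omega] at ihj
          rw [show i - 1 + 1 = i by omega] at hi
          rw [show j - 1 + 1 = j by omega] at hj
          omega
        -- South step: `C` is at most `i`, `j` and one more than the cell above, which gives the
        -- upper bound.
        · left
          rintro ⟨i, j⟩ hq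
          rw [Finset.HasAntidiagonal.mem_antidiagonal] at hq
          simp only at hq ⊢
          have hi := h.left_le (i - 1) j
          have ihi := ih (i - 1) j
          have := h.le_fst i j
          have := h.le_snd i j
          simp only [cornerSum, hq] at ihi ⊢
          by_cases hi0 : i = 0
          · omega
          rw [show i - 1 + j = m by omega] at ihi
          rw [show i - 1 + 1 = i by omega] at hi
          omega
      have hsum := congrFun hs (m + 1)
      intro i j hij
      have hmem : (i, j) ∈ antidiagonal (m + 1) :=
        Finset.HasAntidiagonal.mem_antidiagonal.mpr hij
      rcases hcmp with hle | hle
      · exact (Finset.sum_eq_sum_iff_of_le hle).mp hsum _ hmem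
      · exact ((Finset.sum_eq_sum_iff_of_le hle).mp hsum.symm _ hmem).symm
  funext i j
  exact key _ i j rfl

/-- A sequence with the properties of the sequence of heights of a Dyck path comes from a Dyck
path. -/
theorem exists_south_eq {n : ℕ} {a : ℕ → ℕ} (h0 : a 0 = 0)
    (hstep : ∀ k, a (k + 1) = a k ∨ a (k + 1) = a k + 1) (hle : ∀ k, 2 * a k ≤ k)
    (hn : ∀ k, 2 * n ≤ k → a k = n) : ∃ p : DyckWord, p.semilength = n ∧ ∀ k, south p k = a k := by
  set f : ℕ → DyckStep := fun k => if a (k + 1) = a k then DyckStep.U else DyckStep.D with hf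
  have hD : ∀ k, ((List.range k).map f).count DyckStep.D = a k := by
    intro k
    induction k with
    | zero => simp [h0]
    | succ k ih =>
      rw [List.range_succ, List.map_append, List.count_append, ih]
      rcases hstep k with h | h <;> simp [hf, h]
  have hU : ∀ k, ((List.range k).map f).count DyckStep.U = k - a k := by
    intro k
    induction k with
    | zero => simp
    | succ k ih =>
      rw [List.range_succ, List.map_append, List.count_append, ih]
      have := hle k
      rcases hstep k with h | h
      · simp [hf, h]
        omega
      · simp [hf, h]
  have htake : ∀ k, ((List.range (2 * n)).map f).take k = (List.range (min k (2 * n))).map f := by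
    intro k
    rw [← List.map_take, List.take_range]
  have ha : ∀ k, a (min k (2 * n)) = a k := by
    intro k
    rcases le_total k (2 * n) with h | h
    · rw [min_eq_left h]
    · rw [min_eq_right h, hn _ le_rfl, hn _ h]
  refine ⟨⟨(List.range (2 * n)).map f, ?_, fun k => ?_⟩, ?_, fun k => ?_⟩
  · rw [hU, hD, hn _ le_rfl]
    omega
  · rw [htake, hU, hD]
    have := hle (min k (2 * n))
    omega
  · simp only [DyckWord.semilength]
    rw [hU, hn _ le_rfl]
    omega
  · simp only [south]
    rw [htake, hD, ha]

end DyckPath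

/-! ### The bijection -/

theorem IsCornerSum.exists_dyckWord {n : ℕ} {C : ℕ → ℕ → ℕ} (h : IsCornerSum n C)
    (hu : ∀ C', IsCornerSum n C' → antidiagonalSum C' = antidiagonalSum C → C' = C) :
    ∃ p : DyckWord, p.semilength = n ∧ DyckPath.cornerSum p = C := by
  -- The middle cells of successive antidiagonals form a staircase with unit steps right and down,
  -- so the values on it grow by `0` or `1`.
  obtain ⟨p, hp, hsouth⟩ := DyckPath.exists_south_eq (n := n) (a := fun k => C (k / 2) (k - k / 2))
    (h.zero_left _) (fun k => by
      rcases Nat.even_or_odd' k with ⟨c, rfl | rfl⟩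
      · have h1 := h.le_right c c
        have h2 := h.right_le c c
        rw [show (2 * c + 1) / 2 = c by omega, show 2 * c / 2 = c by omega,
          show 2 * c + 1 - c = c + 1 by omega, show 2 * c - c = c by omega]
        omega
      · have h1 := h.le_left c (c + 1)
        have h2 := h.left_le c (c + 1)
        rw [show (2 * c + 1) / 2 = c by omega, show (2 * c + 1 + 1) / 2 = c + 1 by omega,
          show 2 * c + 1 - c = c + 1 by omega, show 2 * c + 1 + 1 - (c + 1) = c + 1 by omega]
        omega)
    (fun k => by
      have := h.le_fst (k / 2) (k - k / 2)
      omega)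
    (fun k hk => by
      rw [h.left_full _ _ (by omega)]
      omega)
  refine ⟨p, hp, ?_⟩
  funext i j
  rw [DyckPath.cornerSum, hsouth]
  exact (h.eq_min_of_unique hu i j).symm

theorem mainTheorem1 (n : ℕ) :
    Set.BijOn (DyckPath.toMatrix n) {p : DyckWord | p.semilength = n}
      {A : Matrix (Fin n) (Fin n) ℤ | IsDeterminedByXRay A} := by
  refine ⟨fun p (hp : p.semilength = n) => ?_,
    fun p (hp : p.semilength = n) q (hq : q.semilength = n) e => ?_, fun A hA => ?_⟩
  · have hC := DyckPath.isCornerSum hp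
    change IsDeterminedByXRay _
    rw [DyckPath.toMatrix_eq_diffMatrix hp]
    refine ⟨hC.isASM_diffMatrix, fun B hB hx => ?_⟩
    obtain ⟨C, h, rfl⟩ := hB.exists_eq_diffMatrix
    rw [DyckPath.cornerSum_unique hp h ((h.xray_eq_iff hC).mp hx)]
  · rw [DyckPath.toMatrix_eq_diffMatrix hp, DyckPath.toMatrix_eq_diffMatrix hq] at e
    have hC := diffMatrix_injective (DyckPath.isCornerSum hp) (DyckPath.isCornerSum hq) e
    refine DyckPath.eq_of_south_eq hp hq fun k => ?_
    -- At the middle cell of antidiagonal `k` the minimum is `south p k`, since `2 * south p k ≤ k`.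
    have := congrFun (congrFun hC (k / 2)) (k - k / 2)
    simp only [DyckPath.cornerSum] at this
    rw [show k / 2 + (k - k / 2) = k by omega] at this
    have := DyckPath.two_mul_south_le p k
    have := DyckPath.two_mul_south_le q k
    omega
  · obtain ⟨hASM, hu⟩ := hA
    obtain ⟨C, h, rfl⟩ := hASM.exists_eq_diffMatrix
    obtain ⟨p, hp, rfl⟩ := h.exists_dyckWord fun C' h' hs =>
      diffMatrix_injective h' h (hu _ h'.isASM_diffMatrix ((h'.xray_eq_iff h).mpr hs))
    exact ⟨p, hp, DyckPath.toMatrix_eq_diffMatrix hp⟩
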